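/- For $a,b>0$ and real $r\ne 1$ let $$C_r(a,b)=\Big(\frac{b^r+a^r}{b+a}\Big)^{\frac1{r-1}},$$ and, taking limits, let $C_1(a,b)=\big(b^b a^a\big)^{\frac1{b+a}}$, $C_{+\infty}(a,b)=\max(a,b)$ and $C_{-\infty}(a,b)=\min(a,b)$. Let $r\in[0,+\infty)$ and let $a,b>0$ with $a\neq b$. Then $$C_{+\infty}(a,b)\,C_r(a,b)+C_{-\infty}(a,b)\,C_{-r}(a,b)<a^2+b^2.$$ -/

import Mathlib

/-- The generalized inverse harmonic mean `C_r(a, b)` of two positive numbers `a, b`, for an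
extended real parameter `r`: it is `((b ^ r + a ^ r) / (b + a)) ^ (1 / (r - 1))` for real `r ≠ 1`,
and at `r = 1`, `r = +∞`, `r = -∞` it is the limit of this expression, which is
`(b ^ b * a ^ a) ^ (1 / (b + a))`, `max a b`, `min a b`, respectively. -/
noncomputable def genInvHarmonicMean (r : EReal) (a b : ℝ) : ℝ :=
  if r = ⊤ then max a b
  else if r = ⊥ then min a b
  else if r = 1 then (b ^ b * a ^ a) ^ (1 / (b + a))
  else ((b ^ r.toReal + a ^ r.toReal) / (b + a)) ^ (1 / (r.toReal - 1))

/-!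
`C_r` is the power mean of order `r - 1` with weights proportional to the numbers averaged, hence
homogeneous and monotone in `r`. For `0 ≤ r ≤ 2` this gives `C_{-r} ≤ C_0 < C_2` and `C_r ≤ C_2`,
and `(max + min) * C_2 = a ^ 2 + b ^ 2`; negative `r` follows from `-r` by `C_r ≤ C_{-r}`.

For `r > 1` take `a = exp (-t)`, `b = exp t`. With `K = cosh (r t) / cosh t`, the two means are
`K ^ (1 / (r - 1))` and `K ^ (-1 / (r + 1))`, so in terms of `y = t - log K / (r - 1)` and
`z = t - log K / (r + 1)` the claim is `exp (2 t - y) + exp (z - 2 t) < exp (2 t) + exp (-2 t)`.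
As `0 < y ≤ z ≤ t`, concavity of `s ↦ 1 - exp (-s)` reduces it to `z < exp (3 t) * y`, which follows
from an upper bound for `log K`.
-/

open Finset Real

section PowerMean

variable {ι : Type*} {s : Finset ι} {w z : ι → ℝ} {p q : ℝ}

/-- The power mean of order `p` of the positive numbers `z i`, `i ∈ s`, with weights `w i` of
sum `1`. At `p = 0` it is the limit as `p → 0`, the weighted geometric mean. -/
noncomputable def powerMean (s : Finset ι) (w z : ι → ℝ) (p : ℝ) : ℝ :=
  if p = 0 then ∏ i ∈ s, z i ^ w i else (∑ i ∈ s, w i * z i ^ p) ^ (1 / p)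

theorem powerMean_zero : powerMean s w z 0 = ∏ i ∈ s, z i ^ w i :=
  if_pos rfl

theorem powerMean_of_ne_zero (hp : p ≠ 0) :
    powerMean s w z p = (∑ i ∈ s, w i * z i ^ p) ^ (1 / p) :=
  if_neg hp

theorem sum_mul_rpow_nonneg (hw : ∀ i ∈ s, 0 ≤ w i) (hz : ∀ i ∈ s, 0 ≤ z i) (p : ℝ) :
    0 ≤ ∑ i ∈ s, w i * z i ^ p :=
  sum_nonneg fun i hi ↦ mul_nonneg (hw i hi) (rpow_nonneg (hz i hi) p)

theorem powerMean_pos (hw : ∀ i ∈ s, 0 ≤ w i) (hw' : ∑ i ∈ s, w i = 1) (hz : ∀ i ∈ s, 0 < z i)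
    (p : ℝ) : 0 < powerMean s w z p := by
  rcases eq_or_ne p 0 with rfl | hp
  · rw [powerMean_zero]
    exact prod_pos fun i hi ↦ rpow_pos_of_pos (hz i hi) _
  · obtain ⟨i, hi, hwi⟩ : ∃ i ∈ s, 0 < w i :=
      (sum_pos_iff_of_nonneg hw).1 (hw' ▸ one_pos)
    rw [powerMean_of_ne_zero hp]
    refine rpow_pos_of_pos (sum_pos' (fun j hj ↦ ?_) ⟨i, hi, ?_⟩) _
    · exact mul_nonneg (hw j hj) (rpow_nonneg (hz j hj).le p)
    · exact mul_pos hwi (rpow_pos_of_pos (hz i hi) p)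

theorem powerMean_neg (hw : ∀ i ∈ s, 0 ≤ w i) (hz : ∀ i ∈ s, 0 ≤ z i) (p : ℝ) :
    powerMean s w z (-p) = (powerMean s w z⁻¹ p)⁻¹ := by
  rcases eq_or_ne p 0 with rfl | hp
  · rw [neg_zero, powerMean_zero, powerMean_zero, ← prod_inv_distrib]
    exact prod_congr rfl fun i hi ↦ by rw [Pi.inv_apply, inv_rpow (hz i hi), inv_inv]
  · have hsum : ∑ i ∈ s, w i * z⁻¹ i ^ p = ∑ i ∈ s, w i * z i ^ (-p) :=
      sum_congr rfl fun i hi ↦ by rw [Pi.inv_apply, inv_rpow (hz i hi), rpow_neg (hz i hi)]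
    rw [powerMean_of_ne_zero hp, powerMean_of_ne_zero (neg_ne_zero.2 hp), hsum,
      one_div_neg_eq_neg_one_div, rpow_neg (sum_mul_rpow_nonneg hw hz (-p))]

theorem powerMean_const_mul {c : ℝ} (hc : 0 < c) (hw : ∀ i ∈ s, 0 ≤ w i)
    (hw' : ∑ i ∈ s, w i = 1) (hz : ∀ i ∈ s, 0 ≤ z i) (p : ℝ) :
    powerMean s w (fun i ↦ c * z i) p = c * powerMean s w z p := by
  rcases eq_or_ne p 0 with rfl | hp
  · rw [powerMean_zero, powerMean_zero,
      prod_congr rfl fun i hi ↦ mul_rpow hc.le (hz i hi), prod_mul_distrib,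
      ← rpow_sum_of_pos hc, hw', rpow_one]
  · have hsum : ∑ i ∈ s, w i * (c * z i) ^ p = c ^ p * ∑ i ∈ s, w i * z i ^ p := by
      rw [mul_sum]
      exact sum_congr rfl fun i hi ↦ by rw [mul_rpow hc.le (hz i hi), mul_left_comm]
    rw [powerMean_of_ne_zero hp, powerMean_of_ne_zero hp, hsum,
      mul_rpow (by positivity) (sum_mul_rpow_nonneg hw hz p), one_div, rpow_rpow_inv hc.le hp]

theorem powerMean_zero_le (hw : ∀ i ∈ s, 0 ≤ w i) (hw' : ∑ i ∈ s, w i = 1)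
    (hz : ∀ i ∈ s, 0 ≤ z i) (hp : 0 < p) : powerMean s w z 0 ≤ powerMean s w z p := by
  have hprod : (∏ i ∈ s, z i ^ w i) ^ p = ∏ i ∈ s, (z i ^ p) ^ w i := by
    rw [← finsetProd_rpow s _ fun i hi ↦ rpow_nonneg (hz i hi) (w i)]
    exact prod_congr rfl fun i hi ↦ by rw [← rpow_mul (hz i hi), ← rpow_mul (hz i hi), mul_comm]
  rw [powerMean_zero, powerMean_of_ne_zero hp.ne', one_div,
    le_rpow_inv_iff_of_pos (prod_nonneg fun i hi ↦ rpow_nonneg (hz i hi) (w i))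
      (sum_mul_rpow_nonneg hw hz p) hp, hprod]
  exact geom_mean_le_arith_mean_weighted s w _ hw hw' fun i hi ↦ rpow_nonneg (hz i hi) p

theorem powerMean_le_powerMean_of_pos (hw : ∀ i ∈ s, 0 ≤ w i) (hw' : ∑ i ∈ s, w i = 1)
    (hz : ∀ i ∈ s, 0 ≤ z i) (hp : 0 < p) (hpq : p ≤ q) :
    powerMean s w z p ≤ powerMean s w z q := by
  have hq : 0 < q := hp.trans_le hpq
  have hsum : ∑ i ∈ s, w i * (z i ^ p) ^ (q / p) = ∑ i ∈ s, w i * z i ^ q :=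
    sum_congr rfl fun i hi ↦ by rw [← rpow_mul (hz i hi), mul_div_cancel₀ q hp.ne']
  have hjensen := rpow_arith_mean_le_arith_mean_rpow s w (fun i ↦ z i ^ p) hw hw'
    (fun i hi ↦ rpow_nonneg (hz i hi) p) ((one_le_div hp).2 hpq)
  have hnonneg := sum_mul_rpow_nonneg hw hz p
  rw [powerMean_of_ne_zero hp.ne', powerMean_of_ne_zero hq.ne', one_div q,
    le_rpow_inv_iff_of_pos (by positivity) (sum_mul_rpow_nonneg hw hz q) hq, ← hsum,
    ← rpow_mul hnonneg, one_div_mul_eq_div]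
  exact hjensen

theorem powerMean_le_powerMean_of_nonneg (hw : ∀ i ∈ s, 0 ≤ w i) (hw' : ∑ i ∈ s, w i = 1)
    (hz : ∀ i ∈ s, 0 ≤ z i) (hp : 0 ≤ p) (hpq : p ≤ q) :
    powerMean s w z p ≤ powerMean s w z q := by
  rcases hp.eq_or_lt with rfl | hp
  · rcases hpq.eq_or_lt with rfl | hq
    · exact le_rfl
    · exact powerMean_zero_le hw hw' hz hq
  · exact powerMean_le_powerMean_of_pos hw hw' hz hp hpq

theorem powerMean_mono (hw : ∀ i ∈ s, 0 ≤ w i) (hw' : ∑ i ∈ s, w i = 1)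
    (hz : ∀ i ∈ s, 0 < z i) : Monotone (powerMean s w z) := by
  have hz₀ : ∀ i ∈ s, 0 ≤ z i := fun i hi ↦ (hz i hi).le
  have hz_inv : ∀ i ∈ s, 0 < z⁻¹ i := fun i hi ↦ inv_pos.2 (hz i hi)
  have mono_nonpos {p q : ℝ} (hq : q ≤ 0) (hpq : p ≤ q) :
      powerMean s w z p ≤ powerMean s w z q := by
    rw [← neg_neg p, ← neg_neg q, powerMean_neg hw hz₀, powerMean_neg hw hz₀]
    exact inv_anti₀ (powerMean_pos hw hw' hz_inv _) <| powerMean_le_powerMean_of_nonneg hw hw'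
      (fun i hi ↦ (hz_inv i hi).le) (neg_nonneg.2 hq) (neg_le_neg hpq)
  intro p q hpq
  rcases le_total 0 p with hp | hp
  · exact powerMean_le_powerMean_of_nonneg hw hw' hz₀ hp hpq
  rcases le_total q 0 with hq | hq
  · exact mono_nonpos hq hpq
  · exact (mono_nonpos le_rfl hp).trans (powerMean_le_powerMean_of_nonneg hw hw' hz₀ le_rfl hq)

/-- The weights proportional to the numbers `z i`, `i ∈ s`, of nonzero sum. The generalized inverse
harmonic means are the power means of `a`, `b` with these weights. -/
noncomputable def proportionalWeight (s : Finset ι) (z : ι → ℝ) (i : ι) : ℝ :=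
  z i / ∑ j ∈ s, z j

theorem proportionalWeight_nonneg (hz : ∀ i ∈ s, 0 ≤ z i) :
    ∀ i ∈ s, 0 ≤ proportionalWeight s z i :=
  fun i hi ↦ div_nonneg (hz i hi) (sum_nonneg hz)

theorem sum_proportionalWeight (hz : ∑ i ∈ s, z i ≠ 0) :
    ∑ i ∈ s, proportionalWeight s z i = 1 := by
  simp only [proportionalWeight]
  rw [← sum_div, div_self hz]

theorem proportionalWeight_const_mul {c : ℝ} (hc : c ≠ 0) (s : Finset ι) (z : ι → ℝ) :
    proportionalWeight s (fun i ↦ c * z i) = proportionalWeight s z := by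
  funext i
  rw [proportionalWeight, ← mul_sum, mul_div_mul_left _ _ hc, proportionalWeight]

end PowerMean

section GenInvHarmonicMean

variable {a b c r : ℝ}

theorem genInvHarmonicMean_top (a b : ℝ) : genInvHarmonicMean ⊤ a b = max a b :=
  if_pos rfl

theorem genInvHarmonicMean_bot (a b : ℝ) : genInvHarmonicMean ⊥ a b = min a b := by
  rw [genInvHarmonicMean, if_neg bot_ne_top, if_pos rfl]

theorem genInvHarmonicMean_comm (r : EReal) (a b : ℝ) :
    genInvHarmonicMean r a b = genInvHarmonicMean r b a := by
  simp only [genInvHarmonicMean, max_comm a b, min_comm a b, add_comm, mul_comm]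

theorem genInvHarmonicMean_one (a b : ℝ) :
    genInvHarmonicMean ((1 : ℝ) : EReal) a b = (b ^ b * a ^ a) ^ (1 / (b + a)) := by
  rw [genInvHarmonicMean, if_neg (EReal.coe_ne_top 1), if_neg (EReal.coe_ne_bot 1),
    if_pos EReal.coe_one]

theorem genInvHarmonicMean_coe (hr : r ≠ 1) (a b : ℝ) :
    genInvHarmonicMean r a b = ((b ^ r + a ^ r) / (b + a)) ^ (1 / (r - 1)) := by
  rw [genInvHarmonicMean, if_neg (EReal.coe_ne_top r), if_neg (EReal.coe_ne_bot r),
    if_neg (EReal.coe_eq_one.not.2 hr), EReal.toReal_coe]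

theorem genInvHarmonicMean_zero (a b : ℝ) :
    genInvHarmonicMean ((0 : ℝ) : EReal) a b = (a + b) / 2 := by
  rw [genInvHarmonicMean_coe zero_ne_one, rpow_zero, rpow_zero, one_add_one_eq_two, zero_sub,
    one_div_neg_one_eq_neg_one, rpow_neg_one, inv_div, add_comm]

theorem genInvHarmonicMean_two (a b : ℝ) :
    genInvHarmonicMean ((2 : ℝ) : EReal) a b = (a ^ 2 + b ^ 2) / (a + b) := by
  rw [genInvHarmonicMean_coe (by norm_num), rpow_two, rpow_two, add_comm (b ^ 2), add_comm b]
  norm_num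

theorem genInvHarmonicMean_eq_powerMean (ha : 0 < a) (hb : 0 < b) (r : ℝ) :
    genInvHarmonicMean r a b =
      powerMean univ (proportionalWeight univ ![b, a]) ![b, a] (r - 1) := by
  have hweight₀ : proportionalWeight univ ![b, a] 0 = b / (b + a) := by
    simp [proportionalWeight]
  have hweight₁ : proportionalWeight univ ![b, a] 1 = a / (b + a) := by
    simp [proportionalWeight]
  rcases eq_or_ne r 1 with rfl | hr
  · rw [genInvHarmonicMean_one, sub_self, powerMean_zero, Fin.prod_univ_two, hweight₀, hweight₁,
      mul_rpow (by positivity) (by positivity), ← rpow_mul hb.le, ← rpow_mul ha.le, mul_one_div,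
      mul_one_div]
    rfl
  · have hmul_rpow {x : ℝ} (hx : 0 < x) : x / (b + a) * x ^ (r - 1) = x ^ r / (b + a) := by
      rw [rpow_sub_one hx.ne']
      field_simp
    rw [genInvHarmonicMean_coe hr, powerMean_of_ne_zero (sub_ne_zero.2 hr), Fin.sum_univ_two,
      hweight₀, hweight₁, Matrix.cons_val_zero, Matrix.cons_val_one, Matrix.cons_val_zero,
      hmul_rpow hb, hmul_rpow ha, add_div]

theorem forall_mem_univ_pair_pos (ha : 0 < a) (hb : 0 < b) : ∀ i ∈ univ, 0 < ![b, a] i := by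
  simp only [mem_univ, forall_const, Fin.forall_fin_two]
  exact ⟨hb, ha⟩

theorem genInvHarmonicMean_mono (ha : 0 < a) (hb : 0 < b) :
    Monotone fun r : ℝ ↦ genInvHarmonicMean r a b := by
  have hpos := forall_mem_univ_pair_pos ha hb
  intro r s hrs
  simp only [genInvHarmonicMean_eq_powerMean ha hb]
  exact powerMean_mono (proportionalWeight_nonneg fun i hi ↦ (hpos i hi).le)
    (sum_proportionalWeight (sum_pos hpos univ_nonempty).ne') hpos (sub_le_sub_right hrs 1)

theorem genInvHarmonicMean_const_mul (hc : 0 < c) (ha : 0 < a) (hb : 0 < b) (r : ℝ) :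
    genInvHarmonicMean r (c * a) (c * b) = c * genInvHarmonicMean r a b := by
  have hpos := forall_mem_univ_pair_pos ha hb
  have hnonneg : ∀ i ∈ univ, 0 ≤ ![b, a] i := fun i hi ↦ (hpos i hi).le
  have hsmul : ![c * b, c * a] = fun i ↦ c * ![b, a] i := by
    funext i
    fin_cases i <;> rfl
  rw [genInvHarmonicMean_eq_powerMean (mul_pos hc ha) (mul_pos hc hb),
    genInvHarmonicMean_eq_powerMean ha hb, hsmul, proportionalWeight_const_mul hc.ne',
    powerMean_const_mul hc (proportionalWeight_nonneg hnonneg)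
      (sum_proportionalWeight (sum_pos hpos univ_nonempty).ne') hnonneg]

theorem genInvHarmonicMean_exp_neg_exp (hr : r ≠ 1) (t : ℝ) :
    genInvHarmonicMean r (exp (-t)) (exp t) =
      exp (log (cosh (r * t) / cosh t) / (r - 1)) := by
  have hcosh : (exp t ^ r + exp (-t) ^ r) / (exp t + exp (-t)) = cosh (r * t) / cosh t := by
    rw [← exp_mul, ← exp_mul, cosh_eq, cosh_eq, div_div_div_cancel_right₀ two_ne_zero, neg_mul,
      mul_comm t]
  rw [genInvHarmonicMean_coe hr, hcosh, rpow_def_of_pos (by positivity), mul_one_div]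

end GenInvHarmonicMean

section Exponential

variable {r s t w y z : ℝ}

theorem one_sub_exp_neg_mul_le (hy : 0 < y) (hyz : y ≤ z) :
    (1 - exp (-z)) * y ≤ (1 - exp (-y)) * z := by
  have hz : 0 < z := hy.trans_le hyz
  have hsecant := convexOn_exp.secant_mono (Set.mem_univ 0) (Set.mem_univ (-z)) (Set.mem_univ (-y))
    (neg_ne_zero.2 hz.ne') (neg_ne_zero.2 hy.ne') (neg_le_neg hyz)
  rw [exp_zero, sub_zero, sub_zero, div_neg, div_neg, neg_le_neg_iff, div_le_div_iff₀ hy hz]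
    at hsecant
  linarith

theorem exp_sub_add_exp_sub_lt (hy : 0 < y) (hyz : y ≤ z) (hzt : z ≤ t)
    (hz_lt : z < exp (3 * t) * y) :
    exp (2 * t - y) + exp (z - 2 * t) < exp (2 * t) + exp (-(2 * t)) := by
  have hz : 0 < z := hy.trans_le hyz
  have hfactor : exp (-(2 * t)) * (exp z - 1) * z < exp (2 * t) * (1 - exp (-y)) * z := by
    calc exp (-(2 * t)) * (exp z - 1) * z
        < exp (-(2 * t)) * (exp z - 1) * (exp (3 * t) * y) := by
          have : 0 < exp z - 1 := sub_pos.2 (one_lt_exp_iff.2 hz)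
          gcongr
      _ = exp t * (exp z - 1) * y := by
          have : exp t = exp (-(2 * t)) * exp (3 * t) := by
            rw [← exp_add]
            ring_nf
          rw [this]
          ring
      _ = exp (t + z) * ((1 - exp (-z)) * y) := by
          rw [exp_add, exp_neg]
          field_simp
      _ ≤ exp (2 * t) * ((1 - exp (-y)) * z) := by
          have : 0 ≤ 1 - exp (-z) := sub_nonneg.2 (exp_le_one_iff.2 (neg_nonpos.2 hz.le))
          have : t + z ≤ 2 * t := by linarith
          gcongr exp ?_ * ?_
          exact one_sub_exp_neg_mul_le hy hyz
      _ = exp (2 * t) * (1 - exp (-y)) * z := by ring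
  have := lt_of_mul_lt_mul_right hfactor hz.le
  rw [sub_eq_add_neg (2 * t), sub_eq_add_neg z, exp_add, exp_add]
  linarith

theorem two_mul_sq_add_one_mul_log_le (hw : 1 ≤ w) : (2 * w ^ 2 + 1) * log w ≤ w ^ 3 - 1 := by
  have hw₀ : 0 < w := one_pos.trans_le hw
  have hlog : log w ≤ (w - w⁻¹) / 2 := by
    rw [← sinh_log hw₀]
    exact self_le_sinh_iff.2 (log_nonneg hw)
  calc (2 * w ^ 2 + 1) * log w ≤ (2 * w ^ 2 + 1) * ((w - w⁻¹) / 2) := by gcongr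
    _ = w ^ 3 - 1 - (w - 1) ^ 2 / (2 * w) := by
      field_simp
      ring
    _ ≤ w ^ 3 - 1 := sub_le_self _ (by positivity)

theorem div_le_exp_mul_cosh_div_cosh_add (hs : 0 ≤ s) (t : ℝ) :
    (1 + 2 * s) * (exp t ^ 2 + 1) / ((1 + 2 * s) * exp t ^ 2 + 1) ≤
      exp s * cosh t / cosh (s + t) := by
  have hexp : 1 + 2 * s ≤ exp s ^ 2 := by
    rw [← exp_nat_mul, Nat.cast_ofNat, add_comm]
    exact add_one_le_exp (2 * s)
  calc (1 + 2 * s) * (exp t ^ 2 + 1) / ((1 + 2 * s) * exp t ^ 2 + 1)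
      ≤ exp s ^ 2 * (exp t ^ 2 + 1) / (exp s ^ 2 * exp t ^ 2 + 1) := by
        rw [div_le_div_iff₀ (by positivity) (by positivity)]
        linarith [mul_le_mul_of_nonneg_right hexp (show 0 ≤ exp t ^ 2 + 1 by positivity)]
    _ = exp s * cosh t / cosh (s + t) := by
        rw [cosh_eq, cosh_eq, exp_neg, exp_neg, exp_add]
        field_simp

theorem log_cosh_add_div_cosh_le (hs : 0 ≤ s) (t : ℝ) :
    log (cosh (s + t) / cosh t) ≤
      s - 2 * s / (exp t ^ 2 + 1 + s * (2 * exp t ^ 2 + 1)) := by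
  set D := (1 + 2 * s) * exp t ^ 2 + 1 with hD
  have hD₀ : 0 < D := by positivity
  have hratio : 1 + 2 * s / D ≤ exp s * (cosh t / cosh (s + t)) := by
    calc 1 + 2 * s / D = (1 + 2 * s) * (exp t ^ 2 + 1) / D := by
          rw [one_add_div hD₀.ne', hD]
          ring
      _ ≤ exp s * (cosh t / cosh (s + t)) := by
          rw [← mul_div_assoc]
          exact div_le_exp_mul_cosh_div_cosh_add hs t
  have hlog : 2 * s / (exp t ^ 2 + 1 + s * (2 * exp t ^ 2 + 1)) ≤ log (1 + 2 * s / D) := by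
    convert le_log_one_add_of_nonneg (show 0 ≤ 2 * s / D by positivity) using 1
    rw [hD]
    field_simp
    ring
  have hmono := log_le_log (by positivity) hratio
  rw [log_mul (exp_ne_zero s) (by positivity), log_exp, ← inv_div (cosh (s + t)), log_inv] at hmono
  linarith

theorem log_cosh_add_div_cosh_lt (hs : 0 < s) (t : ℝ) : log (cosh (s + t) / cosh t) < s :=
  (log_cosh_add_div_cosh_le hs.le t).trans_lt (sub_lt_self s (by positivity))

theorem sub_log_cosh_div_lt_exp_mul (hr : 1 < r) (ht : 0 < t) :
    t - log (cosh (r * t) / cosh t) / (r + 1) <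
      exp (3 * t) * (t - log (cosh (r * t) / cosh t) / (r - 1)) := by
  obtain ⟨k, hk, rfl⟩ : ∃ k, 0 < k ∧ r = k + 1 := ⟨r - 1, sub_pos.2 hr, by ring⟩
  rw [show (k + 1) * t = k * t + t by ring, show k + 1 + 1 = k + 2 by ring, add_sub_cancel_right,
    show exp (3 * t) = exp t ^ 3 from exp_nat_mul t 3]
  have hkt : 0 < k * t := mul_pos hk ht
  set u := log (cosh (k * t + t) / cosh t)
  set e := exp t
  have he : 1 < e := one_lt_exp_iff.2 ht
  have hcube : t * (2 * e ^ 2 + 1) ≤ e ^ 3 - 1 := by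
    have := two_mul_sq_add_one_mul_log_le he.le
    rwa [log_exp, mul_comm] at this
  have hv : 0 < k * t - u := sub_pos.2 (log_cosh_add_div_cosh_lt hkt t)
  have hsquare : e ^ 2 + 1 < 2 * e ^ 3 := by
    linarith [pow_lt_pow_right₀ he (show 2 < 3 by simp), one_lt_pow₀ he three_ne_zero]
  have hlog : 2 * (k * t) ≤ (k * t - u) * (e ^ 2 + 1 + k * t * (2 * e ^ 2 + 1)) := by
    rw [← div_le_iff₀ (by positivity)]
    linarith [log_cosh_add_div_cosh_le hkt.le t]
  have hmain : 2 * (k * t) < (k * t - u) * (2 * e ^ 3 + k * (e ^ 3 - 1)) := by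
    refine hlog.trans_lt (mul_lt_mul_of_pos_left ?_ hv)
    linarith [mul_le_mul_of_nonneg_left hcube hk.le]
  rw [sub_div' (by positivity), sub_div' hk.ne', mul_div_assoc', div_lt_div_iff₀ (by positivity) hk]
  linarith

end Exponential

section Inequality

variable {a b r t : ℝ}

theorem exp_mul_genInvHarmonicMean_add_lt (hr : 1 < r) (ht : 0 < t) :
    exp t * genInvHarmonicMean r (exp (-t)) (exp t) +
        exp (-t) * genInvHarmonicMean ((-r : ℝ) : EReal) (exp (-t)) (exp t) <
      exp (-t) ^ 2 + exp t ^ 2 := by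
  have hlt := sub_log_cosh_div_lt_exp_mul hr ht
  have hlog_lt := log_cosh_add_div_cosh_lt (mul_pos (sub_pos.2 hr) ht) t
  have hlog_nonneg : 0 ≤ log (cosh (r * t) / cosh t) := by
    refine log_nonneg ((one_le_div (cosh_pos t)).2 (cosh_le_cosh.2 ?_))
    rw [abs_of_pos ht, abs_of_pos (by positivity)]
    exact le_mul_of_one_le_left ht.le hr.le
  rw [show (r - 1) * t + t = r * t by ring] at hlog_lt
  rw [genInvHarmonicMean_exp_neg_exp hr.ne', genInvHarmonicMean_exp_neg_exp (by linarith),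
    neg_mul, cosh_neg]
  set u := log (cosh (r * t) / cosh t)
  have hy : 0 < t - u / (r - 1) := by
    rwa [sub_pos, div_lt_iff₀' (sub_pos.2 hr)]
  have hyz : t - u / (r - 1) ≤ t - u / (r + 1) := by
    have := sub_pos.2 hr
    gcongr
    linarith
  have hzt : t - u / (r + 1) ≤ t := sub_le_self t (by positivity)
  calc exp t * exp (u / (r - 1)) + exp (-t) * exp (u / (-r - 1))
      = exp (2 * t - (t - u / (r - 1))) + exp (t - u / (r + 1) - 2 * t) := by
        rw [← exp_add, ← exp_add, ← neg_add', div_neg]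
        ring_nf
    _ < exp (2 * t) + exp (-(2 * t)) := exp_sub_add_exp_sub_lt hy hyz hzt hlt
    _ = exp (-t) ^ 2 + exp t ^ 2 := by
        rw [← exp_nat_mul, ← exp_nat_mul, Nat.cast_ofNat, mul_neg, add_comm]

theorem mul_genInvHarmonicMean_add_lt_of_one_lt (hr : 1 < r) (ha : 0 < a) (hab : a < b) :
    b * genInvHarmonicMean r a b + a * genInvHarmonicMean ((-r : ℝ) : EReal) a b
      < a ^ 2 + b ^ 2 := by
  obtain ⟨c, t, hc, ht, rfl, rfl⟩ :
      ∃ c t, 0 < c ∧ 0 < t ∧ a = c * exp (-t) ∧ b = c * exp t := by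
    have hb : 0 < b := ha.trans hab
    refine ⟨exp ((log b + log a) / 2), (log b - log a) / 2, exp_pos _,
      half_pos (sub_pos.2 (log_lt_log ha hab)), ?_, ?_⟩
    · rw [← exp_add, ← sub_eq_add_neg, ← sub_div, add_sub_sub_cancel, add_self_div_two, exp_log ha]
    · rw [← exp_add, ← add_div, add_add_sub_cancel, add_self_div_two, exp_log hb]
  rw [genInvHarmonicMean_const_mul hc (exp_pos _) (exp_pos _),
    genInvHarmonicMean_const_mul hc (exp_pos _) (exp_pos _)]
  have := mul_lt_mul_of_pos_left (exp_mul_genInvHarmonicMean_add_lt hr ht) (pow_pos hc 2)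
  linarith

theorem mul_genInvHarmonicMean_add_lt_of_le_two (hr₀ : 0 ≤ r) (hr₂ : r ≤ 2) (ha : 0 < a)
    (hab : a < b) :
    b * genInvHarmonicMean r a b + a * genInvHarmonicMean ((-r : ℝ) : EReal) a b
      < a ^ 2 + b ^ 2 := by
  have hb : 0 < b := ha.trans hab
  have hr_le := genInvHarmonicMean_mono ha hb hr₂
  have hneg_le := genInvHarmonicMean_mono ha hb (neg_nonpos.2 hr₀)
  have hzero_lt_two : (a + b) / 2 < (a ^ 2 + b ^ 2) / (a + b) := by
    rw [div_lt_div_iff₀ two_pos (by positivity)]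
    linarith [sq_pos_of_pos (sub_pos.2 hab)]
  simp only [genInvHarmonicMean_zero, genInvHarmonicMean_two] at hr_le hneg_le
  calc b * genInvHarmonicMean r a b + a * genInvHarmonicMean ((-r : ℝ) : EReal) a b
      < b * ((a ^ 2 + b ^ 2) / (a + b)) + a * ((a ^ 2 + b ^ 2) / (a + b)) := by
        exact add_lt_add_of_le_of_lt (mul_le_mul_of_nonneg_left hr_le hb.le)
          (mul_lt_mul_of_pos_left (hneg_le.trans_lt hzero_lt_two) ha)
    _ = a ^ 2 + b ^ 2 := by field_simp; ring

theorem mul_genInvHarmonicMean_add_lt_of_lt (r : ℝ) (ha : 0 < a) (hab : a < b) :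
    b * genInvHarmonicMean r a b + a * genInvHarmonicMean ((-r : ℝ) : EReal) a b
      < a ^ 2 + b ^ 2 := by
  wlog hr : 0 ≤ r generalizing r
  · have hneg := this (-r) (neg_nonneg.2 (not_le.1 hr).le)
    have hle := genInvHarmonicMean_mono ha (ha.trans hab) (show r ≤ -r by linarith)
    rw [neg_neg] at hneg
    linarith [mul_le_mul_of_nonneg_left hle (sub_nonneg.2 hab.le)]
  rcases le_or_gt r 2 with hr₂ | hr₂
  · exact mul_genInvHarmonicMean_add_lt_of_le_two hr hr₂ ha hab
  · exact mul_genInvHarmonicMean_add_lt_of_one_lt (one_lt_two.trans hr₂) ha hab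

end Inequality

theorem corollary4p3_general (r : ℝ) (a b : ℝ) (ha : 0 < a) (hb : 0 < b) (hab : a ≠ b) :
    genInvHarmonicMean ⊤ a b * genInvHarmonicMean (r : EReal) a b
      + genInvHarmonicMean ⊥ a b * genInvHarmonicMean ((-r : ℝ) : EReal) a b
      < a ^ 2 + b ^ 2 := by
  wlog h : a < b generalizing a b
  · simpa only [genInvHarmonicMean_comm _ a b, add_comm (a ^ 2)] using
      this b a hb ha hab.symm (hab.lt_or_gt.resolve_left h)
  rw [genInvHarmonicMean_top, genInvHarmonicMean_bot, max_eq_right h.le, min_eq_left h.le]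
  exact mul_genInvHarmonicMean_add_lt_of_lt r ha h

theorem corollary4p3 (r : ℝ) (hr : 0 ≤ r) (a b : ℝ) (ha : 0 < a) (hb : 0 < b) (hab : a ≠ b) :
    genInvHarmonicMean ⊤ a b * genInvHarmonicMean (r : EReal) a b
      + genInvHarmonicMean ⊥ a b * genInvHarmonicMean ((-r : ℝ) : EReal) a b
      < a ^ 2 + b ^ 2 :=
  corollary4p3_general r a b ha hb hab
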